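/- Let $A$ be a rational $m\times n$ matrix, let $C=\{x\in\mathbb{R}^n: Ax\le \mathbf 0\}$, and let $R\subseteq\mathbb{Q}^n$ be a set of vectors with $C=\operatorname{cone}(R)$, the set of nonnegative combinations of elements of $R$. A face of a polyhedron $\{x: Bx\le d\}$ is a nonempty subset obtained by imposing equality on some of the inequalities of the system, possibly none. A polyhedron is integer if each of its faces contains an integer point, and $C$ is box-integer if $C\cap\{x:\ell\le x\le u\}$ is integer for all $\ell,u\in\mathbb{Z}^n$. A rational $r\times n$ matrix is equimodular if it has rank $r$ and its nonzero $r\times r$ determinants all have the same absolute value. For a face $F$ of $C$, let $\operatorname{lin}(F)=\{x: A_Fx=\mathbf 0\}$, where $A_F$ consists of the rows $a^\top$ of $A$ with $a^\top y=0$ for all $y\in F$. A finite set $S\subseteq R$ generates a face of $C$ if there is a face $F$ of $C$ such that $S\subseteq F$ and $S$ spans the linear space $\operatorname{lin}(F)$. Then $C$ is box-integer if and only if, for every linearly independent subset $S$ of $R$ that generates a face of $C$, the matrix $S^\top$ whose rows are the elements of $S$ is equimodular. -/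

import Mathlib

open scoped Matrix

/-- A rational vector, viewed in `ℝⁿ`. -/
def ratVec {n : ℕ} (v : Fin n → ℚ) : Fin n → ℝ := fun j => (v j : ℝ)

/-- The polyhedron `{x ∈ ℝⁿ : A x ≤ b}` described by a rational system `A x ≤ b`. -/
def polyhedron {ι : Type*} {n : ℕ} (A : Matrix ι (Fin n) ℚ) (b : ι → ℚ) : Set (Fin n → ℝ) :=
  {x | ∀ i, ratVec (A i) ⬝ᵥ x ≤ (b i : ℝ)}

/-- `F` is a face of `{x : A x ≤ b}`: a nonempty set obtained by imposing equality on some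
of the inequalities of the description. -/
def IsFace {ι : Type*} {n : ℕ} (A : Matrix ι (Fin n) ℚ) (b : ι → ℚ)
    (F : Set (Fin n → ℝ)) : Prop :=
  F.Nonempty ∧
    ∃ I : Set ι, F = {x | x ∈ polyhedron A b ∧ ∀ i ∈ I, ratVec (A i) ⬝ᵥ x = (b i : ℝ)}

/-- The inequality `aᵢ x ≤ bᵢ` is tight for `F`. -/
def IsTight {ι : Type*} {n : ℕ} (A : Matrix ι (Fin n) ℚ) (b : ι → ℚ)
    (F : Set (Fin n → ℝ)) (i : ι) : Prop :=
  ∀ x ∈ F, ratVec (A i) ⬝ᵥ x = (b i : ℝ)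

/-- `lin(F) = {x : A_F x = 0}`, where `A_F` consists of the rows of `A` that are tight for `F`. -/
def lin {ι : Type*} {n : ℕ} (A : Matrix ι (Fin n) ℚ) (b : ι → ℚ)
    (F : Set (Fin n → ℝ)) : Set (Fin n → ℝ) :=
  {x | ∀ i, IsTight A b F i → ratVec (A i) ⬝ᵥ x = 0}

/-- The polyhedron `{x : A x ≤ b}` is integer: each of its faces contains an integer point. -/
def IsInteger {ι : Type*} {n : ℕ} (A : Matrix ι (Fin n) ℚ) (b : ι → ℚ) : Prop :=
  ∀ F, IsFace A b F → ∃ z : Fin n → ℤ, (fun j => (z j : ℝ)) ∈ F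

/-- The constraint matrix of the system `A x ≤ b, x ≤ u, -x ≤ -ℓ`. -/
def boxMatrix {ι : Type*} {n : ℕ} (A : Matrix ι (Fin n) ℚ) :
    Matrix (ι ⊕ Fin n ⊕ Fin n) (Fin n) ℚ :=
  Matrix.fromRows A (Matrix.fromRows 1 (-1))

/-- The right-hand side of the system `A x ≤ b, x ≤ u, -x ≤ -ℓ`. -/
def boxRhs {ι : Type*} {n : ℕ} (b : ι → ℚ) (l u : Fin n → ℤ) : ι ⊕ Fin n ⊕ Fin n → ℚ :=
  Sum.elim b (Sum.elim (fun j => (u j : ℚ)) (fun j => -(l j : ℚ)))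

/-- The system `A x ≤ b, x ≤ u, -x ≤ -ℓ` describes `{x : A x ≤ b} ∩ {x : ℓ ≤ x ≤ u}`. -/
theorem polyhedron_box {ι : Type*} {n : ℕ} (A : Matrix ι (Fin n) ℚ) (b : ι → ℚ)
    (l u : Fin n → ℤ) :
    polyhedron (boxMatrix A) (boxRhs b l u) =
      polyhedron A b ∩ {x | ∀ j, (l j : ℝ) ≤ x j ∧ x j ≤ (u j : ℝ)} := by
  have h1 : ∀ (j : Fin n) (x : Fin n → ℝ),
      ratVec ((1 : Matrix (Fin n) (Fin n) ℚ) j) ⬝ᵥ x = x j := by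
    intro j x
    simp [ratVec, dotProduct, Matrix.one_apply, apply_ite (Rat.cast : ℚ → ℝ)]
  have h2 : ∀ (j : Fin n) (x : Fin n → ℝ),
      ratVec ((-1 : Matrix (Fin n) (Fin n) ℚ) j) ⬝ᵥ x = -x j := by
    intro j x
    simp [ratVec, dotProduct, Matrix.one_apply, apply_ite (Rat.cast : ℚ → ℝ)]
  ext x
  constructor
  · intro h
    refine ⟨fun i => h (Sum.inl i), fun j => ⟨?_, ?_⟩⟩
    · have := h (Sum.inr (Sum.inr j))
      change ratVec ((-1 : Matrix (Fin n) (Fin n) ℚ) j) ⬝ᵥ x ≤ ((-(l j : ℚ) : ℚ) : ℝ) at this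
      rw [h2] at this
      push_cast at this
      linarith
    · have := h (Sum.inr (Sum.inl j))
      change ratVec ((1 : Matrix (Fin n) (Fin n) ℚ) j) ⬝ᵥ x ≤ (((u j : ℚ) : ℚ) : ℝ) at this
      rw [h1] at this
      push_cast at this
      exact this
  · rintro ⟨h, hb⟩ (i | j | j)
    · exact h i
    · change ratVec ((1 : Matrix (Fin n) (Fin n) ℚ) j) ⬝ᵥ x ≤ (((u j : ℚ) : ℚ) : ℝ)
      rw [h1]
      push_cast
      exact (hb j).2
    · change ratVec ((-1 : Matrix (Fin n) (Fin n) ℚ) j) ⬝ᵥ x ≤ ((-(l j : ℚ) : ℚ) : ℝ)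
      rw [h2]
      push_cast
      linarith [(hb j).1]

/-- The polyhedron `{x : A x ≤ b}` is box-integer: its intersection with every integer box
`{x : ℓ ≤ x ≤ u}` is an integer polyhedron. -/
def IsBoxInteger {ι : Type*} {n : ℕ} (A : Matrix ι (Fin n) ℚ) (b : ι → ℚ) : Prop :=
  ∀ l u : Fin n → ℤ, IsInteger (boxMatrix A) (boxRhs b l u)

/-- `cone(R)`: the set of nonnegative combinations of elements of `R`. -/
def coneOf {n : ℕ} (R : Set (Fin n → ℚ)) : Set (Fin n → ℝ) :=
  (PointedCone.hull ℝ (ratVec '' R) : Set (Fin n → ℝ))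

/-- A rational matrix is equimodular if it has full row rank and its nonzero maximal
determinants (one for each choice of as many distinct columns as there are rows) all have the
same absolute value. -/
def IsEquimodular {ι : Type*} [Fintype ι] [DecidableEq ι] {n : ℕ}
    (M : Matrix ι (Fin n) ℚ) : Prop :=
  M.rank = Fintype.card ι ∧
    ∀ f g : ι ↪ Fin n, (M.submatrix id f).det ≠ 0 → (M.submatrix id g).det ≠ 0 →
      |(M.submatrix id f).det| = |(M.submatrix id g).det|

/-- `Sᵀ`: the matrix whose rows are the elements of `S`. -/
def rowsMatrix {n : ℕ} (S : Finset (Fin n → ℚ)) : Matrix S (Fin n) ℚ :=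
  Matrix.of fun s => s.1

/-- `S` generates a face of `{x : A x ≤ 0}`: it lies in some face `F` and spans `lin(F)`. -/
def GeneratesFace {ι : Type*} {n : ℕ} (A : Matrix ι (Fin n) ℚ) (S : Finset (Fin n → ℚ)) :
    Prop :=
  ∃ F, IsFace A 0 F ∧ (∀ s ∈ S, ratVec s ∈ F) ∧
    (Submodule.span ℝ (ratVec '' (S : Set (Fin n → ℚ))) : Set (Fin n → ℝ)) = lin A 0 F

/-! Write `N = M_f⁻¹ M` for a column basis `f` of a full-row-rank `M`. Equimodularity means that `N`
is integral for every `f`: ratios of maximal determinants of `M` are minors of `N`, and by Cramer's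
rule so are the entries of `N`.

If `C` is box-integer and `S` generates a face `F`, a row of `N` plus a suitable integer combination
of `S` is a point `v` of `F` that is integer on `f`. The integer box around `v` contains an integer
point of `F`, which agrees with `v` on `f` and hence everywhere (`exists_int_of_isBoxInteger`), so
the row is integral.

Conversely, take a vertex `x` of a face of `C` cut by a box, and the minimal face of `C` containing
`x`. Generators in that face contain a basis `S` of its linear space. Since `x` is a vertex, a
column basis can be chosen among the integer coordinates of `x`
(`exists_det_ne_zero_of_forall_vecMul`), and integrality of `N` spreads from these to all
coordinates. -/

/-- The basis change `M_f⁻¹ M`, where `M_f` consists of the columns of `M` chosen by `f`. -/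
noncomputable def basisForm {ι : Type*} [Fintype ι] [DecidableEq ι] {n : ℕ}
    (M : Matrix ι (Fin n) ℚ) (f : ι ↪ Fin n) : Matrix ι (Fin n) ℚ :=
  (M.submatrix id f)⁻¹ * M

/-! ### Equimodularity as integrality of basis changes -/

section Equimodular

variable {ι : Type*} [Fintype ι] [DecidableEq ι] {n : ℕ}

theorem basisForm_apply_self {M : Matrix ι (Fin n) ℚ} {f : ι ↪ Fin n}
    (hf : (M.submatrix id f).det ≠ 0) (i k : ι) :
    basisForm M f i (f k) = (1 : Matrix ι ι ℚ) i k := by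
  rw [← Matrix.nonsing_inv_mul (M.submatrix id f) hf.isUnit]
  rfl

theorem det_submatrix_eq_mul {M : Matrix ι (Fin n) ℚ} {f : ι ↪ Fin n}
    (hf : (M.submatrix id f).det ≠ 0) (g : ι → Fin n) :
    (M.submatrix id g).det =
      (M.submatrix id f).det * ((basisForm M f).submatrix id g).det := by
  rw [← Matrix.det_mul]
  congr 1
  have h : M.submatrix id f * basisForm M f = M := by
    rw [basisForm, ← Matrix.mul_assoc, Matrix.mul_nonsing_inv _ hf.isUnit, Matrix.one_mul]
  conv_lhs => rw [← h]
  rfl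

/-- The ratio of the two determinants is a minor of an integer matrix; being a nonzero integer, it
has absolute value at least 1. -/
theorem abs_det_le_of_basisForm_integral {M : Matrix ι (Fin n) ℚ} {f : ι ↪ Fin n}
    (hf : (M.submatrix id f).det ≠ 0) (hN : ∀ i j, ∃ z : ℤ, basisForm M f i j = z)
    {g : ι → Fin n} (hg : (M.submatrix id g).det ≠ 0) :
    |(M.submatrix id f).det| ≤ |(M.submatrix id g).det| := by
  choose Z hZ using hN
  have hdet : ((basisForm M f).submatrix id g).det =
      (((Matrix.of Z).submatrix id g).det : ℤ) := by
    rw [Int.cast_det]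
    congr 1
    ext i j
    simp [hZ]
  rw [det_submatrix_eq_mul hf g] at hg ⊢
  rw [hdet] at hg ⊢
  rw [abs_mul]
  refine le_mul_of_one_le_right (abs_nonneg _) ?_
  have h0 : ((Matrix.of Z).submatrix id g).det ≠ 0 := by
    intro h
    simp [h] at hg
  exact_mod_cast Int.one_le_abs h0

theorem isEquimodular_of_basisForm_integral {M : Matrix ι (Fin n) ℚ}
    (hM : M.rank = Fintype.card ι)
    (h : ∀ f : ι ↪ Fin n, (M.submatrix id f).det ≠ 0 → ∀ i j, ∃ z : ℤ, basisForm M f i j = z) :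
    IsEquimodular M :=
  ⟨hM, fun f g hf hg => le_antisymm (abs_det_le_of_basisForm_integral hf (h f hf) hg)
    (abs_det_le_of_basisForm_integral hg (h g hg) hf)⟩

theorem det_mul_basisForm {M : Matrix ι (Fin n) ℚ} {f : ι ↪ Fin n}
    (hf : (M.submatrix id f).det ≠ 0) (i : ι) (j : Fin n) :
    (M.submatrix id f).det * basisForm M f i j =
      (M.submatrix id (Function.update f i j)).det := by
  have h := congrFun
    (Matrix.det_smul_inv_mulVec_eq_cramer (M.submatrix id f) (fun k => M k j) hf.isUnit) i
  rw [Matrix.cramer_apply] at h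
  have hcol : (M.submatrix id f).updateCol i (fun k => M k j) =
      M.submatrix id (Function.update f i j) := by
    ext a b
    by_cases hb : b = i
    · subst hb; simp
    · simp [hb]
  rw [← hcol, ← h]
  rfl

/-- By Cramer's rule each entry is a ratio of two maximal determinants of `M`, hence 0 or ±1. -/
theorem IsEquimodular.basisForm_integral {M : Matrix ι (Fin n) ℚ} (hM : IsEquimodular M)
    {f : ι ↪ Fin n} (hf : (M.submatrix id f).det ≠ 0) (i : ι) (j : Fin n) :
    ∃ z : ℤ, basisForm M f i j = z := by
  have h := det_mul_basisForm hf i j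
  by_cases h0 : (M.submatrix id (Function.update f i j)).det = 0
  · rw [h0] at h
    exact ⟨0, by simpa using (mul_eq_zero.mp h).resolve_left hf⟩
  have hinj : Function.Injective (Function.update f i j) := by
    intro a b hab
    by_contra hne
    exact h0 (Matrix.det_zero_of_column_eq hne fun k => by simp [hab])
  have habs := hM.2 f ⟨_, hinj⟩ hf h0
  change _ = |(M.submatrix id (Function.update f i j)).det| at habs
  rw [← h, abs_mul] at habs
  have h1 : |basisForm M f i j| = 1 :=
    mul_left_cancel₀ (abs_ne_zero.mpr hf) (by rw [← habs, mul_one])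
  rcases eq_or_eq_neg_of_abs_eq h1 with h1 | h1
  · exact ⟨1, by simpa using h1⟩
  · exact ⟨-1, by simpa using h1⟩

/-- If the rows of `M` remain independent after restriction to the columns in `J`, then some
nonzero maximal determinant uses only columns in `J`. -/
theorem exists_det_ne_zero_of_forall_vecMul (M : Matrix ι (Fin n) ℚ) (J : Set (Fin n))
    (h : ∀ w : ι → ℚ, (∀ j ∈ J, (w ᵥ* M) j = 0) → w = 0) :
    ∃ f : ι ↪ Fin n, (∀ i, f i ∈ J) ∧ (M.submatrix id f).det ≠ 0 := by
  -- If the columns in `J` did not span, a nonzero functional would vanish on them; its coefficients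
  -- form a forbidden `w`.
  have htop : Submodule.span ℚ (Set.range fun j : J => fun i => M i j) = ⊤ := by
    by_contra hne
    obtain ⟨φ, hφ, hle⟩ := Submodule.exists_le_ker_of_lt_top _ (lt_top_iff_ne_top.mpr hne)
    apply hφ
    have hw := h (fun i => φ fun k => if i = k then 1 else 0) fun j hj => by
      have := hle (Submodule.subset_span ⟨⟨j, hj⟩, rfl⟩)
      rw [LinearMap.mem_ker, LinearMap.pi_apply_eq_sum_univ] at this
      refine Eq.trans ?_ this
      simp only [Matrix.vecMul, dotProduct, smul_eq_mul]
      exact Finset.sum_congr rfl fun _ _ => mul_comm _ _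
    ext1 i
    refine LinearMap.ext_ring ?_
    have hi := congrFun hw i
    simp only [Pi.zero_apply] at hi
    simp only [LinearMap.comp_apply, LinearMap.single_apply, LinearMap.zero_apply]
    refine Eq.trans (congrArg φ ?_) hi
    ext k
    simp [Pi.single_apply, eq_comm]
  obtain ⟨κ, a, ha, hspan, hli⟩ :=
    exists_linearIndependent' ℚ (fun j : J => fun i => M i j)
  rw [htop] at hspan
  have : Finite κ := Finite.of_injective a ha
  have : Fintype κ := Fintype.ofFinite κ
  have hcard : Fintype.card κ = Fintype.card ι := by
    have := Module.finrank_eq_card_basis (Module.Basis.mk hli hspan.ge)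
    rw [← this, Module.finrank_fintype_fun_eq_card]
  let e : ι ≃ κ := (Fintype.equivOfCardEq hcard).symm
  refine ⟨⟨fun i => (a (e i)).1, Subtype.val_injective.comp (ha.comp e.injective)⟩,
    fun i => (a (e i)).2, ?_⟩
  have hu : LinearIndependent ℚ (M.submatrix id (fun i => (a (e i)).1)).col :=
    hli.comp e e.injective
  exact ((Matrix.isUnit_iff_isUnit_det _).mp
    (Matrix.linearIndependent_cols_iff_isUnit.mp hu)).ne_zero

/-- Since `M = M_f N`, a vector of the row space is recovered from its coordinates on `f`: integer
or zero there forces integer or zero everywhere. -/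
theorem submatrix_vecMul_basisForm {M : Matrix ι (Fin n) ℚ} {f : ι ↪ Fin n}
    (hf : (M.submatrix id f).det ≠ 0) (w : ι → ℝ) :
    (fun k => (w ᵥ* M.map ((↑) : ℚ → ℝ)) (f k)) ᵥ* (basisForm M f).map ((↑) : ℚ → ℝ) =
      w ᵥ* M.map ((↑) : ℚ → ℝ) := by
  have h : M.submatrix id f * basisForm M f = M := by
    rw [basisForm, ← Matrix.mul_assoc, Matrix.mul_nonsing_inv _ hf.isUnit, Matrix.one_mul]
  have h' : (M.submatrix id f).map ((↑) : ℚ → ℝ) * (basisForm M f).map ((↑) : ℚ → ℝ) =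
      M.map ((↑) : ℚ → ℝ) := by
    conv_rhs => rw [← h]
    exact (Matrix.map_mul (f := Rat.castHom ℝ)).symm
  conv_rhs => rw [← h', ← Matrix.vecMul_vecMul]
  rfl

/-- A vector of the row space of `M` that is integer on the columns chosen by `f` is integer. -/
theorem exists_int_of_basisForm_integral {M : Matrix ι (Fin n) ℚ} {f : ι ↪ Fin n}
    (hf : (M.submatrix id f).det ≠ 0) (hN : ∀ i j, ∃ z : ℤ, basisForm M f i j = z)
    (w : ι → ℝ) (hw : ∀ k, ∃ z : ℤ, (w ᵥ* M.map ((↑) : ℚ → ℝ)) (f k) = z) (j : Fin n) :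
    ∃ z : ℤ, (w ᵥ* M.map ((↑) : ℚ → ℝ)) j = z := by
  choose Z hZ using hN
  choose y hy using hw
  refine ⟨∑ k, y k * Z k j, ?_⟩
  rw [← submatrix_vecMul_basisForm hf w]
  rw [Matrix.vecMul, dotProduct]
  simp [hy, hZ]

end Equimodular

/-! ### Faces, vertices and the linear space of a face -/

section Polyhedra

variable {ι : Type*} {n : ℕ}

theorem boxMatrix_inl (A : Matrix ι (Fin n) ℚ) (i : ι) : boxMatrix A (Sum.inl i) = A i := rfl

theorem boxMatrix_upper_dotProduct (A : Matrix ι (Fin n) ℚ) (j : Fin n) (x : Fin n → ℝ) :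
    ratVec (boxMatrix A (Sum.inr (Sum.inl j))) ⬝ᵥ x = x j := by
  change ratVec ((1 : Matrix (Fin n) (Fin n) ℚ) j) ⬝ᵥ x = x j
  simp [ratVec, dotProduct, Matrix.one_apply, apply_ite (Rat.cast : ℚ → ℝ)]

theorem boxMatrix_lower_dotProduct (A : Matrix ι (Fin n) ℚ) (j : Fin n) (x : Fin n → ℝ) :
    ratVec (boxMatrix A (Sum.inr (Sum.inr j))) ⬝ᵥ x = -x j := by
  change ratVec ((-1 : Matrix (Fin n) (Fin n) ℚ) j) ⬝ᵥ x = -x j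
  simp [ratVec, dotProduct, Matrix.one_apply, apply_ite (Rat.cast : ℚ → ℝ)]

theorem exists_pos_mul_abs_le [Finite ι] (a b : ι → ℝ) (ha : ∀ i, 0 ≤ a i)
    (hab : ∀ i, a i = 0 → b i = 0) : ∃ ε > 0, ∀ i, ε * |b i| ≤ a i := by
  have hev : ∀ᶠ ε : ℝ in nhdsWithin 0 (Set.Ioi 0), ∀ i, ε * |b i| ≤ a i := by
    rw [Filter.eventually_all]
    intro i
    rcases (ha i).eq_or_lt with h | h
    · simp [hab i h.symm, ha i]
    · have hc : Filter.Tendsto (fun ε : ℝ => ε * |b i|) (nhdsWithin 0 (Set.Ioi 0)) (nhds 0) :=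
        (Continuous.tendsto' (by fun_prop) 0 0 (by simp)).mono_left nhdsWithin_le_nhds
      exact (hc.eventually_lt_const h).mono fun _ => le_of_lt
  obtain ⟨ε, h, hε⟩ := (hev.and self_mem_nhdsWithin).exists
  exact ⟨ε, hε, h⟩

/-- From a point of a face one can move a little, in both directions, along any vector
orthogonal to the constraints tight at that point. -/
theorem exists_add_sub_smul_mem_face [Finite ι] {A : Matrix ι (Fin n) ℚ} {b : ι → ℚ}
    {F : Set (Fin n → ℝ)} (hF : IsFace A b F) {x : Fin n → ℝ} (hx : x ∈ F) {z : Fin n → ℝ}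
    (hz : ∀ i, ratVec (A i) ⬝ᵥ x = b i → ratVec (A i) ⬝ᵥ z = 0) :
    ∃ ε : ℝ, 0 < ε ∧ x + ε • z ∈ F ∧ x - ε • z ∈ F := by
  obtain ⟨-, I, rfl⟩ := hF
  obtain ⟨ε, hε, h⟩ := exists_pos_mul_abs_le (fun i => (b i : ℝ) - ratVec (A i) ⬝ᵥ x)
    (fun i => ratVec (A i) ⬝ᵥ z) (fun i => sub_nonneg.mpr (hx.1 i))
    fun i hi => hz i (sub_eq_zero.mp hi).symm
  refine ⟨ε, hε, ⟨fun i => ?_, fun i hi => ?_⟩, ⟨fun i => ?_, fun i hi => ?_⟩⟩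
  · rw [dotProduct_add, dotProduct_smul, smul_eq_mul]
    nlinarith [h i, le_abs_self (ratVec (A i) ⬝ᵥ z)]
  · rw [dotProduct_add, dotProduct_smul, hz i (hx.2 i hi), hx.2 i hi, smul_zero, add_zero]
  · rw [dotProduct_sub, dotProduct_smul, smul_eq_mul]
    nlinarith [h i, neg_abs_le (ratVec (A i) ⬝ᵥ z)]
  · rw [dotProduct_sub, dotProduct_smul, hz i (hx.2 i hi), hx.2 i hi, smul_zero, sub_zero]

theorem isClosed_face {A : Matrix ι (Fin n) ℚ} {b : ι → ℚ} {F : Set (Fin n → ℝ)}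
    (hF : IsFace A b F) : IsClosed F := by
  obtain ⟨-, I, rfl⟩ := hF
  have hc : ∀ i, Continuous fun x : Fin n → ℝ => ratVec (A i) ⬝ᵥ x := fun i => by
    unfold dotProduct; fun_prop
  simp only [polyhedron, Set.ofPred_forall, Set.ofPred_and]
  exact (isClosed_iInter fun i => isClosed_le (hc i) continuous_const).inter
    (isClosed_iInter fun i => isClosed_iInter fun _ => isClosed_eq (hc i) continuous_const)

/-- A bounded face contains a point whose tight constraints have only the trivial solution. -/
theorem exists_vertex_mem_face [Finite ι] {A : Matrix ι (Fin n) ℚ} {b : ι → ℚ}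
    {F : Set (Fin n → ℝ)} (hF : IsFace A b F) (hb : Bornology.IsBounded F) :
    ∃ x ∈ F, ∀ z : Fin n → ℝ,
      (∀ i, ratVec (A i) ⬝ᵥ x = b i → ratVec (A i) ⬝ᵥ z = 0) → z = 0 := by
  obtain ⟨x, hx⟩ :=
    (Metric.isCompact_of_isClosed_isBounded (isClosed_face hF) hb).extremePoints_nonempty hF.1
  refine ⟨x, hx.1, fun z hz => ?_⟩
  obtain ⟨ε, hε, h1, h2⟩ := exists_add_sub_smul_mem_face hF hx.1 hz
  -- The extreme point `x` is the midpoint of `x + ε • z` and `x - ε • z`, so these coincide with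
  -- it.
  have h := (mem_extremePoints_iff_left.mp hx).2 _ h1 _ h2
    ⟨1 / 2, 1 / 2, by norm_num, by norm_num, by norm_num, by
      ext j; simp; ring⟩
  simpa [hε.ne'] using h

theorem isBounded_box_face {A : Matrix ι (Fin n) ℚ} {b : ι → ℚ} {l u : Fin n → ℤ}
    {F : Set (Fin n → ℝ)} (hF : IsFace (boxMatrix A) (boxRhs b l u) F) :
    Bornology.IsBounded F := by
  obtain ⟨-, I, rfl⟩ := hF
  refine (Metric.isBounded_Icc (fun j => (l j : ℝ)) (fun j => (u j : ℝ))).subset ?_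
  rintro x ⟨hx, -⟩
  rw [polyhedron_box] at hx
  exact ⟨fun j => (hx.2 j).1, fun j => (hx.2 j).2⟩

/-- The smallest face of `{x : A x ≤ 0}` containing `x`. -/
def minFace (A : Matrix ι (Fin n) ℚ) (x : Fin n → ℝ) : Set (Fin n → ℝ) :=
  {y | y ∈ polyhedron A 0 ∧ ∀ i ∈ {i | ratVec (A i) ⬝ᵥ x = 0},
    ratVec (A i) ⬝ᵥ y = (((0 : ι → ℚ) i : ℚ) : ℝ)}

theorem mem_minFace {A : Matrix ι (Fin n) ℚ} {x : Fin n → ℝ} (hx : x ∈ polyhedron A 0) :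
    x ∈ minFace A x :=
  ⟨hx, fun i hi => by simpa using hi⟩

theorem isFace_minFace {A : Matrix ι (Fin n) ℚ} {x : Fin n → ℝ} (hx : x ∈ polyhedron A 0) :
    IsFace A 0 (minFace A x) :=
  ⟨⟨x, mem_minFace hx⟩, _, rfl⟩

theorem mem_lin_minFace {A : Matrix ι (Fin n) ℚ} {x z : Fin n → ℝ} (hx : x ∈ polyhedron A 0) :
    z ∈ lin A 0 (minFace A x) ↔
      ∀ i, ratVec (A i) ⬝ᵥ x = 0 → ratVec (A i) ⬝ᵥ z = 0 := by
  refine forall_congr' fun i => imp_congr_left ⟨fun h => ?_, fun h y hy => hy.2 i h⟩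
  simpa using h x (mem_minFace hx)

/-- The solution set of the tight constraints of a face, as a subspace. -/
def linSubmodule (A : Matrix ι (Fin n) ℚ) (b : ι → ℚ) (F : Set (Fin n → ℝ)) :
    Submodule ℝ (Fin n → ℝ) where
  carrier := lin A b F
  add_mem' hx hy i hi := by rw [dotProduct_add, hx i hi, hy i hi, add_zero]
  zero_mem' i _ := dotProduct_zero _
  smul_mem' c x hx i hi := by rw [dotProduct_smul, hx i hi, smul_zero]

theorem subset_lin {A : Matrix ι (Fin n) ℚ} {F : Set (Fin n → ℝ)} : F ⊆ lin A 0 F :=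
  fun x hx i hi => by simpa using hi x hx

/-- A face of a cone generated by `R` is spanned by the generators that it contains. -/
theorem face_subset_span {A : Matrix ι (Fin n) ℚ} {R : Set (Fin n → ℚ)}
    (hR : polyhedron A 0 = coneOf R) {F : Set (Fin n → ℝ)} (hF : IsFace A 0 F) :
    F ⊆ Submodule.span ℝ (ratVec '' {r | r ∈ R ∧ ratVec r ∈ F}) := by
  obtain ⟨-, I, rfl⟩ := hF
  have hsub : ∀ y ∈ ratVec '' R, y ∈ polyhedron A 0 := fun y hy => by
    rw [hR]
    exact Submodule.subset_span hy
  rintro x ⟨hx, hxI⟩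
  rw [hR] at hx
  obtain ⟨c, hcs, hc0, rfl⟩ := PointedCone.mem_hull_set.mp hx
  refine Submodule.sum_mem _ fun y hy => Submodule.smul_mem _ _ (Submodule.subset_span ?_)
  obtain ⟨r, hr, rfl⟩ := hcs hy
  refine ⟨r, ⟨hr, hsub _ ⟨r, hr, rfl⟩, fun i hi => ?_⟩, rfl⟩
  have h := hxI i hi
  simp only [Pi.zero_apply, Rat.cast_zero, Finsupp.sum, dotProduct_sum, dotProduct_smul,
    smul_eq_mul] at h
  -- A vanishing sum of nonpositive terms: each generator used with nonzero weight is itself tight.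
  have h0 := (Finset.sum_eq_zero_iff_of_nonpos fun y hy =>
    mul_nonpos_of_nonneg_of_nonpos (hc0 y) (by simpa using hsub y (hcs hy) i)).mp h _ hy
  simpa using (mul_eq_zero.mp h0).resolve_left (Finsupp.mem_support_iff.mp hy)

/-- The point `x` is relatively interior to its minimal face, so for `z` in the linear space `x + ε
• z` stays in the face; `z` is then a multiple of a difference of two points of the face, which its
generators span. -/
theorem span_generators_minFace [Finite ι] {A : Matrix ι (Fin n) ℚ} {R : Set (Fin n → ℚ)}
    (hR : polyhedron A 0 = coneOf R) {x : Fin n → ℝ} (hx : x ∈ polyhedron A 0) :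
    Submodule.span ℝ (ratVec '' {r | r ∈ R ∧ ratVec r ∈ minFace A x}) =
      linSubmodule A 0 (minFace A x) := by
  have hF := isFace_minFace hx
  refine le_antisymm (Submodule.span_le.mpr ?_) fun z hz => ?_
  · rintro _ ⟨r, hr, rfl⟩
    exact subset_lin hr.2
  obtain ⟨ε, hε, h1, -⟩ := exists_add_sub_smul_mem_face hF (mem_minFace hx) (z := z)
    fun i hi => (mem_lin_minFace hx).mp hz i (by simpa using hi)
  have h := Submodule.sub_mem _ (face_subset_span hR hF h1)
    (face_subset_span hR hF (mem_minFace hx))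
  rw [add_sub_cancel_left] at h
  exact (Submodule.smul_mem_iff _ hε.ne').mp h

end Polyhedra

/-! ### Rational generators and their real spans -/

section Generators

variable {n : ℕ}

theorem ratVec_vecMul {ι : Type*} [Fintype ι] (w : ι → ℚ) (M : Matrix ι (Fin n) ℚ) :
    ratVec (w ᵥ* M) = (fun i => (w i : ℝ)) ᵥ* M.map ((↑) : ℚ → ℝ) := by
  ext j
  simp [ratVec, Matrix.vecMul, dotProduct]

theorem mem_span_ratVec_iff {S : Finset (Fin n → ℚ)} {x : Fin n → ℝ} :
    x ∈ Submodule.span ℝ (ratVec '' (S : Set (Fin n → ℚ))) ↔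
      ∃ w : S → ℝ, w ᵥ* (rowsMatrix S).map ((↑) : ℚ → ℝ) = x := by
  have hr : ratVec '' (S : Set (Fin n → ℚ)) = Set.range fun s : S => ratVec s.1 := by
    ext y; simp
  rw [hr, Submodule.mem_span_range_iff_exists_fun]
  refine exists_congr fun w => ?_
  rw [Matrix.vecMul_eq_sum]
  rfl

theorem span_ratVec_le_of_span_le {S T : Set (Fin n → ℚ)}
    (h : Submodule.span ℚ T ≤ Submodule.span ℚ S) :
    Submodule.span ℝ (ratVec '' T) ≤ Submodule.span ℝ (ratVec '' S) := by
  refine Submodule.span_le.mpr ?_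
  rintro _ ⟨t, ht, rfl⟩
  have ht' := h (Submodule.subset_span ht)
  clear ht
  rw [SetLike.mem_coe]
  induction ht' using Submodule.span_induction with
  | mem x hx => exact Submodule.subset_span ⟨x, hx, rfl⟩
  | zero => convert Submodule.zero_mem _ using 1; ext; simp [ratVec]
  | add x y _ _ hx hy => convert Submodule.add_mem _ hx hy using 1; ext; simp [ratVec]
  | smul a x _ hx => convert Submodule.smul_mem _ (a : ℝ) hx using 1; ext; simp [ratVec]

theorem exists_finset_basis (T : Set (Fin n → ℚ)) :
    ∃ S : Finset (Fin n → ℚ), (S : Set (Fin n → ℚ)) ⊆ T ∧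
      LinearIndependent ℚ (fun s : S => (s : Fin n → ℚ)) ∧
      Submodule.span ℝ (ratVec '' (S : Set (Fin n → ℚ))) = Submodule.span ℝ (ratVec '' T) := by
  obtain ⟨b, hbT, hspan, hli⟩ := exists_linearIndependent ℚ T
  obtain ⟨S, rfl⟩ := hli.setFinite.exists_finset_coe
  exact ⟨S, hbT, hli, le_antisymm (Submodule.span_mono (Set.image_mono hbT))
    (span_ratVec_le_of_span_le hspan.ge)⟩

theorem exists_common_denominator {ι κ : Type*} [Fintype ι] [Fintype κ] (M : Matrix ι κ ℚ) :
    ∃ D : ℕ, 0 < D ∧ ∀ i j, ∃ z : ℤ, (D : ℚ) * M i j = z := by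
  refine ⟨∏ p : ι × κ, (M p.1 p.2).den, Finset.prod_pos fun p _ => Rat.den_pos _, fun i j => ?_⟩
  obtain ⟨k, hk⟩ := Finset.dvd_prod_of_mem (fun p : ι × κ => (M p.1 p.2).den)
    (Finset.mem_univ (i, j))
  refine ⟨k * (M i j).num, ?_⟩
  rw [hk]
  push_cast
  rw [mul_comm ((M i j).den : ℚ), mul_assoc, Rat.den_mul_eq_num]

/-- Nonnegative combinations of points of a face of a cone lie in that face. -/
theorem vecMul_mem_face {ι : Type*} {A : Matrix ι (Fin n) ℚ} {S : Finset (Fin n → ℚ)}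
    {F : Set (Fin n → ℝ)} (hF : IsFace A 0 F) (hS : ∀ s ∈ S, ratVec s ∈ F) {w : S → ℝ}
    (hw : ∀ s, 0 ≤ w s) : w ᵥ* (rowsMatrix S).map ((↑) : ℚ → ℝ) ∈ F := by
  obtain ⟨-, I, rfl⟩ := hF
  have hdot : ∀ i, ratVec (A i) ⬝ᵥ (w ᵥ* (rowsMatrix S).map ((↑) : ℚ → ℝ)) =
      ∑ s : S, w s * (ratVec (A i) ⬝ᵥ ratVec s.1) := fun i => by
    rw [Matrix.vecMul_eq_sum, dotProduct_sum]
    exact Finset.sum_congr rfl fun s _ => dotProduct_smul _ _ _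
  refine ⟨fun i => ?_, fun i hi => ?_⟩
  · rw [hdot]
    simp only [Pi.zero_apply, Rat.cast_zero]
    exact Finset.sum_nonpos fun s _ => mul_nonpos_of_nonneg_of_nonpos (hw s)
      (by simpa using (hS s s.2).1 i)
  · rw [hdot]
    simp only [Pi.zero_apply, Rat.cast_zero]
    exact Finset.sum_eq_zero fun s _ => by
      rw [(hS s s.2).2 i hi]; simp

/-! ### The two implications -/

/-- In a box-integer cone, a rational point of a face that is integer on a column basis of the
linear space of the face is integer. -/
theorem exists_int_of_isBoxInteger {ι : Type*} {A : Matrix ι (Fin n) ℚ}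
    (hA : IsBoxInteger A 0) {S : Finset (Fin n → ℚ)} {F : Set (Fin n → ℝ)}
    (hF : IsFace A 0 F)
    (hspan : (Submodule.span ℝ (ratVec '' (S : Set (Fin n → ℚ))) : Set (Fin n → ℝ)) =
      lin A 0 F)
    {f : S ↪ Fin n} (hf : ((rowsMatrix S).submatrix id f).det ≠ 0) {v : Fin n → ℝ}
    (hv : v ∈ F) (hvf : ∀ k, ∃ z : ℤ, v (f k) = z) (j : Fin n) : ∃ z : ℤ, v j = z := by
  obtain ⟨-, I, hI⟩ := id hF
  -- The box from `⌊v⌋` to `⌈v⌉` contains `v` and fixes exactly the coordinates where `v` is an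
  -- integer.
  have hface : IsFace (boxMatrix A) (boxRhs 0 (fun j => ⌊v j⌋) (fun j => ⌈v j⌉))
      {x | x ∈ polyhedron (boxMatrix A) (boxRhs 0 (fun j => ⌊v j⌋) (fun j => ⌈v j⌉)) ∧
        ∀ i ∈ Sum.inl '' I, ratVec (boxMatrix A i) ⬝ᵥ x =
          (boxRhs 0 (fun j => ⌊v j⌋) (fun j => ⌈v j⌉) i : ℚ)} := by
    refine ⟨⟨v, ?_, ?_⟩, _, rfl⟩
    · rw [polyhedron_box]
      rw [hI] at hv
      exact ⟨hv.1, fun j => ⟨Int.floor_le _, Int.le_ceil _⟩⟩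
    · rw [hI] at hv
      rintro _ ⟨i, hi, rfl⟩
      exact hv.2 i hi
  obtain ⟨z, hz, hzI⟩ := hA _ _ _ hface
  rw [polyhedron_box] at hz
  have hzF : (fun j => (z j : ℝ)) ∈ F := by
    rw [hI]
    exact ⟨hz.1, fun i hi => hzI _ ⟨i, hi, rfl⟩⟩
  have hmem : (fun j => (z j : ℝ)) - v ∈
      Submodule.span ℝ (ratVec '' (S : Set (Fin n → ℚ))) :=
    Submodule.sub_mem _ (hspan.ge (subset_lin hzF)) (hspan.ge (subset_lin hv))
  obtain ⟨w, hw⟩ := mem_span_ratVec_iff.mp hmem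
  -- The difference of the integer point and `v` vanishes on the column basis, and lies in the row
  -- space, so it is zero.
  have h0 : (fun k => (w ᵥ* (rowsMatrix S).map ((↑) : ℚ → ℝ)) (f k)) = 0 := by
    ext k
    obtain ⟨y, hy⟩ := hvf k
    have h := hz.2 (f k)
    simp only [hy, Int.floor_intCast, Int.ceil_intCast] at h
    rw [hw]
    simp only [Pi.sub_apply, Pi.zero_apply, hy]
    linarith
  have h := submatrix_vecMul_basisForm hf w
  rw [h0, Matrix.zero_vecMul, hw] at h
  refine ⟨z j, ?_⟩
  have hj := congrFun h j
  simp only [Pi.sub_apply, Pi.zero_apply] at hj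
  linarith

theorem basisForm_integral_of_isBoxInteger {ι : Type*} {A : Matrix ι (Fin n) ℚ}
    (hA : IsBoxInteger A 0) {S : Finset (Fin n → ℚ)} (hS : GeneratesFace A S)
    {f : S ↪ Fin n} (hf : ((rowsMatrix S).submatrix id f).det ≠ 0) (i : S) (j : Fin n) :
    ∃ z : ℤ, basisForm (rowsMatrix S) f i j = z := by
  obtain ⟨F, hF, hSF, hspan⟩ := hS
  obtain ⟨D, hD, hDM⟩ := exists_common_denominator (rowsMatrix S)
  choose Z hZ using hDM
  set c : S → ℚ := ((rowsMatrix S).submatrix id f)⁻¹ i with hc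
  obtain ⟨K, hK⟩ : ∃ K : ℕ, ∀ s, -c s ≤ K := by
    obtain ⟨B, hB⟩ := (Set.finite_range fun s => -c s).bddAbove
    obtain ⟨K, hK⟩ := exists_nat_ge B
    exact ⟨K, fun s => (hB ⟨s, rfl⟩).trans hK⟩
  -- Shifting every coefficient by `D * K` makes the combination conic; as `D` clears denominators,
  -- the shift changes the vector by an integer one.
  have hw : ∀ s, 0 ≤ c s + D * K := fun s => by
    have h1 : (K : ℚ) ≤ D * K := by
      exact_mod_cast Nat.le_mul_of_pos_left K hD
    linarith [hK s]
  have hval : ∀ j, (((fun s => c s + D * K) ᵥ* rowsMatrix S) j) =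
      basisForm (rowsMatrix S) f i j + ((K * ∑ s, Z s j : ℤ) : ℚ) := fun j => by
    push_cast
    simp only [Matrix.vecMul, dotProduct, add_mul, Finset.sum_add_distrib, Finset.mul_sum]
    congr 1
    exact Finset.sum_congr rfl fun s _ => by rw [← hZ s j]; ring
  have hv : ratVec ((fun s => c s + D * K) ᵥ* rowsMatrix S) ∈ F := by
    rw [ratVec_vecMul]
    exact vecMul_mem_face hF hSF fun s => by exact_mod_cast hw s
  obtain ⟨z, hz⟩ := exists_int_of_isBoxInteger hA hF hspan hf hv (fun k => by
    simp only [ratVec, hval, basisForm_apply_self hf, Matrix.one_apply]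
    by_cases h : i = k
    · exact ⟨1 + K * ∑ s, Z s (f k), by simp [h]⟩
    · exact ⟨K * ∑ s, Z s (f k), by simp [h]⟩) j
  refine ⟨z - K * ∑ s, Z s j, ?_⟩
  have hz' : ((fun s => c s + D * K) ᵥ* rowsMatrix S) j = z := by
    simp only [ratVec] at hz
    exact_mod_cast hz
  rw [hval] at hz'
  rw [Int.cast_sub, ← hz', add_sub_cancel_right]

theorem isBoxInteger_of_isEquimodular {ι : Type*} [Finite ι] {A : Matrix ι (Fin n) ℚ}
    {R : Set (Fin n → ℚ)} (hR : polyhedron A 0 = coneOf R)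
    (h : ∀ S : Finset (Fin n → ℚ), (S : Set (Fin n → ℚ)) ⊆ R →
      LinearIndependent ℚ (fun s : S => (s : Fin n → ℚ)) →
      GeneratesFace A S → IsEquimodular (rowsMatrix S)) : IsBoxInteger A 0 := by
  intro l u G hG
  obtain ⟨x, hxG, hvert⟩ := exists_vertex_mem_face hG (isBounded_box_face hG)
  obtain ⟨-, I, rfl⟩ := id hG
  have hx : x ∈ polyhedron A 0 := (polyhedron_box A 0 l u ▸ hxG.1).1
  -- A box inequality tight at `x` makes that coordinate an integer, so a direction of the minimal
  -- face that vanishes on all integer coordinates of `x` is orthogonal to every tight constraint.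
  have hvert' : ∀ z ∈ lin A 0 (minFace A x), (∀ j ∈ {j | ∃ y : ℤ, x j = y}, z j = 0) →
      z = 0 := by
    refine fun z hz hzJ => hvert z ?_
    rintro (i | j | j) hi
    · exact (mem_lin_minFace hx).mp hz i (by simpa [boxRhs, boxMatrix_inl] using hi)
    · rw [boxMatrix_upper_dotProduct] at hi ⊢
      exact hzJ j ⟨u j, by simpa [boxRhs] using hi⟩
    · rw [boxMatrix_lower_dotProduct] at hi ⊢
      rw [hzJ j ⟨l j, by simpa [boxRhs] using hi⟩, neg_zero]
  obtain ⟨S, hST, hli, hspan⟩ := exists_finset_basis {r | r ∈ R ∧ ratVec r ∈ minFace A x}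
  rw [span_generators_minFace hR hx] at hspan
  have hspan' : (Submodule.span ℝ (ratVec '' (S : Set (Fin n → ℚ))) : Set (Fin n → ℝ)) =
      lin A 0 (minFace A x) := congrArg SetLike.coe hspan
  have hM := h S (fun s hs => (hST hs).1) hli
    ⟨_, isFace_minFace hx, fun s hs => (hST hs).2, hspan'⟩
  -- A row combination of `S` lies in the linear space of the minimal face; if it vanishes on the
  -- integer coordinates of `x` it is zero, and independence of `S` kills its coefficients.
  obtain ⟨f, hfJ, hf⟩ := exists_det_ne_zero_of_forall_vecMul (rowsMatrix S)
    {j | ∃ y : ℤ, x j = y} fun w hw => by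
      have h0 := hvert' (ratVec (w ᵥ* rowsMatrix S))
        (hspan' ▸ mem_span_ratVec_iff.mpr ⟨_, (ratVec_vecMul _ _).symm⟩)
        fun j hj => by simp [ratVec, hw j hj]
      have h1 : ∑ s : S, w s • (s : Fin n → ℚ) = 0 := by
        have h2 : w ᵥ* rowsMatrix S = 0 := by
          ext j
          simpa [ratVec] using congrFun h0 j
        rwa [Matrix.vecMul_eq_sum] at h2
      exact funext (Fintype.linearIndependent_iff.mp hli w h1)
  have hxs : x ∈ Submodule.span ℝ (ratVec '' (S : Set (Fin n → ℚ))) :=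
    hspan ▸ subset_lin (mem_minFace hx)
  obtain ⟨w, hw⟩ := mem_span_ratVec_iff.mp hxs
  have hint := exists_int_of_basisForm_integral hf (hM.basisForm_integral hf) w
    (fun k => by rw [hw]; exact hfJ k)
  rw [hw] at hint
  choose z hz using hint
  exact ⟨z, by rwa [← funext hz]⟩

end Generators

theorem corollary4p5 {m n : ℕ} (A : Matrix (Fin m) (Fin n) ℚ) (R : Set (Fin n → ℚ))
    (hR : polyhedron A 0 = coneOf R) :
    IsBoxInteger A 0 ↔
      ∀ S : Finset (Fin n → ℚ), (S : Set (Fin n → ℚ)) ⊆ R →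
        LinearIndependent ℚ (fun s : S => (s : Fin n → ℚ)) →
        GeneratesFace A S → IsEquimodular (rowsMatrix S) := by
  refine ⟨fun hA S _ hli hS => ?_, isBoxInteger_of_isEquimodular hR⟩
  exact isEquimodular_of_basisForm_integral
    (LinearIndependent.rank_matrix (M := rowsMatrix S) hli)
    fun f hf => basisForm_integral_of_isBoxInteger hA hS hf
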